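/- Let $n\ge 0$, let $S_n$ be the group of permutations of $[n]=\{1,\dots,n\}$ with its strong Bruhat order $\le$, that is, the reflexive and transitive closure of the relations $u \to v$, where $v$ arises from $u$ by exchanging the values at two positions $i<j$ with $u(i)<u(j)$. For $w\in S_n$ let $M_w$ be the generic $n\times 2n$ matrix whose nonzero entries in row $i$ are in the columns $w(i), w(i)+1,\dots,i+n$ (its nonzero entries are algebraically independent over $\mathbb{Q}$), and let $P_w$ be the set of those $n$-subsets $I$ of $[2n]$ for which the $n\times n$ minor of $M_w$ in columns $I$ is nonzero; $P_w$ is the set of bases of a matroid on $[2n]$. The rank in $P_w$ of a subset $I\subseteq[2n]$ is the maximum of $\#(I\cap B)$ over $B\in P_w$. Order $[2n]$ totally by $$n+1\prec n\prec n+2\prec n-1\prec\cdots\prec 2n\prec 1 .$$ Let $I\subseteq[2n]$ and let $r$ be an integer with $0\le r\le \min(n,\#I)$. Write $I=\{i_1\prec i_2\prec\cdots\}$ and $[2n]\setminus\{i_1,\dots,i_r\}=\{j_1\prec j_2\prec\cdots\}$. Then $$J_r(I)=\{i_1,\dots,i_r,j_1,\dots,j_{n-r}\}$$ is the $\prec$-lexicographically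 smallest $n$-subset $J$ of $[2n]$ with $\#(J\cap I)\ge r$. The set $\{v\in S_n : J_r(I)\in P_v\}$ has a unique maximal element in Bruhat order, denoted $u_{J_r(I)}$. Moreover, for every $w\in S_n$ the following are equivalent: 1. $I$ has rank at least $r$ in $P_w$; 2. $J_r(I)\in P_w$; 3. $u_{J_r(I)}\ge w$ in Bruhat order. -/

import Mathlib

/-! Conventions. The set `[n]` is modelled by `Fin n` and `[2n]` by `Fin (2 * n)`; the element `k`
of `[n]` or `[2n]` corresponds to the index with value `k - 1`. -/

namespace CatalanPositroid

/-- The generic matrix `M_w`: its nonzero entries are independent indeterminates, and those of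
row `i` are in the columns `w(i), w(i) + 1, …, i + n` (this condition has the same form whether
rows, values and columns are all counted from `1` or all counted from `0`). -/
noncomputable def genericMatrix {n : ℕ} (w : Equiv.Perm (Fin n)) :
    Matrix (Fin n) (Fin (2 * n)) (MvPolynomial (Fin n × Fin (2 * n)) ℚ) :=
  Matrix.of fun i c =>
    if (w i : ℕ) ≤ (c : ℕ) ∧ (c : ℕ) ≤ (i : ℕ) + n then MvPolynomial.X (i, c) else 0

/-- `P_w`: the set of `n`-subsets `I` of `[2n]` such that the maximal minor of `M_w` in
columns `I` is nonzero. -/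
def bases {n : ℕ} (w : Equiv.Perm (Fin n)) : Set (Finset (Fin (2 * n))) :=
  {I | ∃ h : I.card = n, ((genericMatrix w).submatrix id (I.orderEmbOfFin h)).det ≠ 0}

/-- The rank of `I` in the matroid with set of bases `B`: the maximal size of the
intersection of `I` with a basis. -/
noncomputable def rankIn {α : Type*} [DecidableEq α] (B : Set (Finset α)) (I : Finset α) : ℕ :=
  sSup ((fun K => (I ∩ K).card) '' B)

/-- The position (counted from `0`) of a column in the total order
`n+1 ≺ n ≺ n+2 ≺ n-1 ≺ ⋯ ≺ 2n ≺ 1` of `[2n]`; with columns counted from `0` this order is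
`n ≺ n-1 ≺ n+1 ≺ n-2 ≺ ⋯ ≺ 2n-1 ≺ 0`. -/
def position {n : ℕ} (c : Fin (2 * n)) : ℕ :=
  if n ≤ (c : ℕ) then 2 * ((c : ℕ) - n) else 2 * (n - 1 - (c : ℕ)) + 1

/-- The strict total order `≺` on `[2n]`. -/
def Prec {n : ℕ} (a b : Fin (2 * n)) : Prop := position a < position b

instance {n : ℕ} (a b : Fin (2 * n)) : Decidable (Prec a b) :=
  inferInstanceAs (Decidable (position a < position b))

/-- `A` is `≺`-lexicographically smaller than `B`, for sets `A`, `B` of the same size: when both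
are listed in `≺`-increasing order, at the first place where the lists differ the entry `a` of `A`
is `≺`-smaller, that is, `a ∈ A`, `a ∉ B`, and `A`, `B` have the same elements `≺ a`. -/
def LexLT {n : ℕ} (A B : Finset (Fin (2 * n))) : Prop :=
  ∃ a ∈ A, a ∉ B ∧ ∀ x, Prec x a → (x ∈ A ↔ x ∈ B)

/-- `J` is the `≺`-lexicographically smallest `n`-set meeting `I` in at least `r` elements. -/
def IsLexSmallest {n : ℕ} (r : ℕ) (I J : Finset (Fin (2 * n))) : Prop :=
  (J.card = n ∧ r ≤ (J ∩ I).card) ∧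
    ∀ K : Finset (Fin (2 * n)), K.card = n → r ≤ (K ∩ I).card → K ≠ J → LexLT J K

/-- The set of the `≺`-first `k` elements of `A` (all of `A` if it has fewer than `k`). -/
def firstElems {n : ℕ} (k : ℕ) (A : Finset (Fin (2 * n))) : Finset (Fin (2 * n)) :=
  A.filter fun x => (A.filter fun y => Prec y x).card < k

/-- `J_r(I)` in explicit form: the `≺`-first `r` elements `i_1, …, i_r` of `I` together with the
`≺`-first `n - r` elements of `[2n] \ {i_1, …, i_r}`. -/
def lexSet {n : ℕ} (r : ℕ) (I : Finset (Fin (2 * n))) : Finset (Fin (2 * n)) :=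
  firstElems r I ∪ firstElems (n - r) (Finset.univ \ firstElems r I)

/-- One upward step in strong Bruhat order: `v` is obtained from `u` by exchanging the values at
two positions `i < j` with `u(i) < u(j)`; such an exchange increases the length. -/
def BruhatStep {n : ℕ} (u v : Equiv.Perm (Fin n)) : Prop :=
  ∃ i j : Fin n, i < j ∧ u i < u j ∧ v = u * Equiv.swap i j

/-- Strong Bruhat order `u ≤ v` on `S_n`. -/
def BruhatLE {n : ℕ} (u v : Equiv.Perm (Fin n)) : Prop :=
  Relation.ReflTransGen BruhatStep u v

/-- `W_I`: the set of permutations `w` such that `I ∈ P_w`. -/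
def permsOf {n : ℕ} (I : Finset (Fin (2 * n))) : Set (Equiv.Perm (Fin n)) :=
  {w | I ∈ bases w}

/-- `v` is a maximal element of `W` in Bruhat order. -/
def IsBruhatMaximal {n : ℕ} (W : Set (Equiv.Perm (Fin n))) (v : Equiv.Perm (Fin n)) : Prop :=
  v ∈ W ∧ ∀ x ∈ W, BruhatLE v x → x = v

/-- `W` has exactly one maximal element in Bruhat order, namely `u`. -/
def IsUniqueMaximal {n : ℕ} (W : Set (Equiv.Perm (Fin n))) (u : Equiv.Perm (Fin n)) : Prop :=
  ∀ v, IsBruhatMaximal W v ↔ v = u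

/-- `u_I`: the unique Bruhat-maximal element of `W_I` (an arbitrary permutation if there is no
such element). -/
noncomputable def uPerm {n : ℕ} (I : Finset (Fin (2 * n))) : Equiv.Perm (Fin n) :=
  Classical.epsilon (IsUniqueMaximal (permsOf I))

end CatalanPositroid

namespace CatalanPositroid

open Finset

/-! ### Bases as transversals -/

/-! Since the nonzero entries of `M_w` are independent, `J` is a basis exactly when the rows can be
matched bijectively with the columns in `J`, row `i` using a column of the interval from `w i` to `i
+ n`. Two independent arguments then carry the theorem.

Conditions 2 and 3: for every `n`-set `J`, the permutations having `J` as a basis form a principal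
Bruhat ideal (`isPrincipal_permsOf`). If a column of `J` in the right half can move one place right,
or one in the left half one place left, into a column outside `J`, then `J` is a basis for `w` iff
the moved set is one for `w` or for `w` times an adjacent transposition, on the right or left
respectively. By the lifting property, enlarging a principal ideal in this way keeps it principal
(`IsReflecting.exists_top`). When nothing can move, `J` consists of the first `k` and the last `n -
k` columns, and the ideal is the Young subgroup preserving the first `k` indices.

Conditions 1 and 2: Hall's condition is checked for `lexSet r I`. Within each half of the columns
the row supports shrink along `≺`, so early columns are the easiest to match. A violation inside the
first `r` elements of `I` would bound the rank of `I` below `r`; a subset containing a filler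
element is small enough to be covered by the support of its first column alone. -/

theorem mem_bases_iff {n : ℕ} (w : Equiv.Perm (Fin n)) (J : Finset (Fin (2 * n))) :
    J ∈ bases w ↔ ∃ φ : Fin n → Fin (2 * n), Function.Injective φ ∧ univ.image φ = J ∧
      ∀ i, (w i : ℕ) ≤ φ i ∧ (φ i : ℕ) ≤ i + n := by
  constructor
  · rintro ⟨h, hdet⟩
    rw [Matrix.det_apply] at hdet
    obtain ⟨σ, -, hσ⟩ := Finset.exists_ne_zero_of_sum_ne_zero hdet
    have hprod : ∏ i, ((genericMatrix w).submatrix id (J.orderEmbOfFin h)) (σ i) i ≠ 0 := by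
      intro h0
      rw [h0, smul_zero] at hσ
      exact hσ rfl
    rw [Finset.prod_ne_zero_iff] at hprod
    refine ⟨fun i => J.orderEmbOfFin h (σ⁻¹ i),
      (J.orderEmbOfFin h).injective.comp (σ⁻¹).injective, ?_, fun i => ?_⟩
    · ext c
      constructor
      · rintro hc
        obtain ⟨i, -, rfl⟩ := Finset.mem_image.1 hc
        exact J.orderEmbOfFin_mem h _
      · intro hc
        have : c ∈ Set.range (J.orderEmbOfFin h) := by
          rw [Finset.range_orderEmbOfFin]; exact hc
        obtain ⟨j, rfl⟩ := this
        exact Finset.mem_image.2 ⟨σ j, mem_univ _, by simp⟩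
    · have := hprod (σ⁻¹ i) (mem_univ _)
      by_contra hcon
      apply this
      simpa [genericMatrix] using hcon
  · rintro ⟨φ, hφ, rfl, hw⟩
    have h : (univ.image φ).card = n := by
      rw [Finset.card_image_of_injective _ hφ, Finset.card_univ, Fintype.card_fin]
    refine ⟨h, fun hdet => ?_⟩
    set e := (univ.image φ).orderEmbOfFin h with he
    have hmem : ∀ i, ∃ j, e j = φ i := by
      intro i
      have : φ i ∈ Set.range e := by
        rw [he, Finset.range_orderEmbOfFin]; simp
      exact this
    choose τ hτ using hmem
    have hτinj : Function.Injective τ := fun a b hab => hφ (by rw [← hτ, ← hτ, hab])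
    let τ' : Equiv.Perm (Fin n) := Equiv.ofBijective τ (Finite.injective_iff_bijective.1 hτinj)
    -- Specializing to the indicator of the matching `φ` leaves a permutation matrix, whose
    -- determinant is a sign.
    let ev : MvPolynomial (Fin n × Fin (2 * n)) ℚ →+* ℚ :=
      MvPolynomial.eval fun x => if φ x.1 = x.2 then 1 else 0
    have hmat : ev.mapMatrix ((genericMatrix w).submatrix id e) =
        (1 : Matrix (Fin n) (Fin n) ℚ).submatrix τ' id := by
      ext i j
      have hij : φ i = e j ↔ τ' i = j := by
        rw [← hτ i]; exact e.injective.eq_iff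
      by_cases hc : τ' i = j
      · have hc' := hij.2 hc
        have := hw i
        rw [hc'] at this
        simp [genericMatrix, this, ev, hc', Matrix.one_apply, hc]
      · have hc' := fun h => hc (hij.1 h)
        simp only [RingHom.mapMatrix_apply, Matrix.map_apply, Matrix.submatrix_apply, id,
          genericMatrix, Matrix.of_apply, Matrix.one_apply, hc, if_false]
        split_ifs
        · simpa [ev] using hc'
        · simp
    have h1 := congrArg ev hdet
    rw [RingHom.map_det, hmat, Matrix.det_permute, map_zero, Matrix.det_one, mul_one] at h1
    simp at h1

theorem image_mem_bases_iff {n : ℕ} (w : Equiv.Perm (Fin n)) (J : Finset (Fin (2 * n)))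
    (g : Equiv.Perm (Fin (2 * n))) :
    J.image g ∈ bases w ↔ ∃ φ : Fin n → Fin (2 * n), Function.Injective φ ∧ univ.image φ = J ∧
      ∀ i, (w i : ℕ) ≤ g (φ i) ∧ (g (φ i) : ℕ) ≤ i + n := by
  rw [mem_bases_iff]
  constructor
  · rintro ⟨φ, hφ, him, hw⟩
    refine ⟨fun i => g⁻¹ (φ i), (g⁻¹).injective.comp hφ, ?_, fun i => by simpa using hw i⟩
    have : (univ.image φ).image ⇑g⁻¹ = J := by
      rw [him, Finset.image_image]; simp
    rw [← this, Finset.image_image]; rfl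
  · rintro ⟨φ, hφ, rfl, hw⟩
    exact ⟨fun i => g (φ i), g.injective.comp hφ, by rw [Finset.image_image]; rfl, hw⟩

/-- Reindexing the rows turns an exchange of the left ends of two row intervals into an exchange of
their right ends, so that one assignment `φ` can be tested for both permutations. -/
theorem image_mem_bases_mul_swap_iff {n : ℕ} (w : Equiv.Perm (Fin n)) (p q : Fin n)
    (J : Finset (Fin (2 * n))) (g : Equiv.Perm (Fin (2 * n))) :
    J.image g ∈ bases (w * Equiv.swap p q) ↔
      ∃ φ : Fin n → Fin (2 * n), Function.Injective φ ∧ univ.image φ = J ∧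
      ∀ i, (w i : ℕ) ≤ g (φ i) ∧ (g (φ i) : ℕ) ≤ Equiv.swap p q i + n := by
  rw [image_mem_bases_iff]
  have him : ∀ φ : Fin n → Fin (2 * n),
      univ.image (fun i => φ (Equiv.swap p q i)) = univ.image φ := by
    intro φ
    have : (fun i => φ (Equiv.swap p q i)) = φ ∘ Equiv.swap p q := rfl
    rw [this, ← Finset.image_image, Finset.image_univ_equiv]
  constructor
  · rintro ⟨φ, hφ, rfl, hw⟩
    refine ⟨fun i => φ (Equiv.swap p q i), hφ.comp (Equiv.swap p q).injective, him φ,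
      fun i => by simpa using hw (Equiv.swap p q i)⟩
  · rintro ⟨φ, hφ, rfl, hw⟩
    refine ⟨fun i => φ (Equiv.swap p q i), hφ.comp (Equiv.swap p q).injective, him φ,
      fun i => by simpa using hw (Equiv.swap p q i)⟩

theorem swap_val_cases {m : ℕ} (p q i : Fin m) :
    (i = p ∧ (Equiv.swap p q i : ℕ) = q) ∨ (i = q ∧ (Equiv.swap p q i : ℕ) = p) ∨
      ((i : ℕ) ≠ p ∧ (i : ℕ) ≠ q ∧ Equiv.swap p q i = i) := by
  by_cases h : i = p
  · left; rw [h, Equiv.swap_apply_left]; exact ⟨rfl, rfl⟩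
  by_cases h' : i = q
  · right; left; rw [h', Equiv.swap_apply_right]; exact ⟨rfl, rfl⟩
  · right; right
    exact ⟨fun h'' => h (Fin.ext h''), fun h'' => h' (Fin.ext h''),
      Equiv.swap_apply_of_ne_of_ne h h'⟩

/-- The same matching serves both sides. Moving `c` to `d` fails only if `c` is matched with row
`p`, whose interval ends at `c`; exchanging the right ends of rows `p` and `q` repairs this. -/
theorem mem_bases_iff_of_row_swap {n : ℕ} (w : Equiv.Perm (Fin n)) {p q : Fin n}
    (hpq : (q : ℕ) = p + 1) {J : Finset (Fin (2 * n))} {c d : Fin (2 * n)}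
    (hc : (c : ℕ) = n + p) (hd : (d : ℕ) = n + p + 1) (hcJ : c ∈ J) (hdJ : d ∉ J) :
    J ∈ bases w ↔ J.image (Equiv.swap c d) ∈ bases w ∨
      J.image (Equiv.swap c d) ∈ bases (w * Equiv.swap p q) := by
  rw [mem_bases_iff, image_mem_bases_iff, image_mem_bases_mul_swap_iff, ← exists_or]
  refine exists_congr fun φ => ?_
  rw [← and_or_left, ← and_or_left]
  refine and_congr_right fun hφ => and_congr_right fun him => ?_
  have hd' : ∀ i, φ i ≠ d := fun i h => hdJ (by rw [← him, ← h]; simp)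
  obtain ⟨i₀, hi₀⟩ : ∃ i, φ i = c := by
    rw [← him] at hcJ; simpa using hcJ
  have hg : ∀ i, (φ i = c ∧ (Equiv.swap c d (φ i) : ℕ) = n + p + 1) ∨
      ((φ i : ℕ) ≠ n + p ∧ (φ i : ℕ) ≠ n + p + 1 ∧ Equiv.swap c d (φ i) = φ i) := by
    intro i
    by_cases h : φ i = c
    · left; rw [h, Equiv.swap_apply_left]; exact ⟨rfl, hd⟩
    · right
      refine ⟨fun h' => h (Fin.ext (by omega)), fun h' => hd' i (Fin.ext (by omega)),
        Equiv.swap_apply_of_ne_of_ne h (hd' i)⟩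
  have hs := swap_val_cases p q
  constructor
  · intro hw
    by_cases hip : i₀ = p
    · right
      intro i
      have h1 := hw i
      rcases hg i with ⟨h, h'⟩ | ⟨h, h', h''⟩
      · have : i = p := by rw [← hip]; exact hφ (h.trans hi₀.symm)
        subst this
        have := (w i).isLt
        rw [h', Equiv.swap_apply_left]; omega
      · rw [h'']
        rcases hs i with ⟨rfl, h2⟩ | ⟨rfl, h2⟩ | ⟨_, _, h2⟩
        · omega
        -- The last column of row `q` is `d`, which is not in `J`, so this row can afford the
        -- shorter interval.
        · have : (φ i : ℕ) ≠ i + n := by omega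
          omega
        · rw [h2]; omega
    · left
      intro i
      have h1 := hw i
      rcases hg i with ⟨h, h'⟩ | ⟨h, h', h''⟩
      · have : i = i₀ := hφ (h.trans hi₀.symm)
        subst this
        have h2 := (w i).isLt
        have : (i : ℕ) ≠ p := fun h => hip (Fin.ext h)
        rw [h] at h1
        omega
      · rw [h'']; exact h1
  · rintro (hw | hw)
    · intro i
      have h1 := hw i
      have h2 := (w i).isLt
      rcases hg i with ⟨h, h'⟩ | ⟨h, h', h''⟩
      · rw [h]; omega
      · rwa [h''] at h1
    · intro i
      have h1 := hw i
      have h2 := (w i).isLt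
      rcases hg i with ⟨h, h'⟩ | ⟨h, h', h''⟩
      · rw [h]
        rcases hs i with ⟨rfl, h2⟩ | ⟨rfl, h2⟩ | ⟨_, _, h2⟩
        · omega
        · omega
        · rw [h2] at h1; omega
      · rw [h''] at h1
        rcases hs i with ⟨rfl, h2⟩ | ⟨rfl, h2⟩ | ⟨_, _, h2⟩
        · omega
        · omega
        · rw [h2] at h1; omega

/-- The mirror image at the left ends: the move fails only for the row with `w i = q`, whose
interval starts at `c`. -/
theorem mem_bases_iff_of_value_swap {n : ℕ} (w : Equiv.Perm (Fin n)) {p q : Fin n}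
    (hpq : (q : ℕ) = p + 1) {J : Finset (Fin (2 * n))} {c d : Fin (2 * n)}
    (hc : (c : ℕ) = p + 1) (hd : (d : ℕ) = p) (hcJ : c ∈ J) (hdJ : d ∉ J) :
    J ∈ bases w ↔ J.image (Equiv.swap c d) ∈ bases w ∨
      J.image (Equiv.swap c d) ∈ bases (Equiv.swap p q * w) := by
  rw [mem_bases_iff, image_mem_bases_iff, image_mem_bases_iff, ← exists_or]
  refine exists_congr fun φ => ?_
  rw [← and_or_left, ← and_or_left]
  refine and_congr_right fun hφ => and_congr_right fun him => ?_
  have hd' : ∀ i, φ i ≠ d := fun i h => hdJ (by rw [← him, ← h]; simp)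
  obtain ⟨i₀, hi₀⟩ : ∃ i, φ i = c := by
    rw [← him] at hcJ; simpa using hcJ
  have hqn := q.isLt
  have hg : ∀ i, (φ i = c ∧ (Equiv.swap c d (φ i) : ℕ) = p) ∨
      ((φ i : ℕ) ≠ p ∧ (φ i : ℕ) ≠ p + 1 ∧ Equiv.swap c d (φ i) = φ i) := by
    intro i
    by_cases h : φ i = c
    · left; rw [h, Equiv.swap_apply_left]; exact ⟨rfl, hd⟩
    · right
      refine ⟨fun h' => hd' i (Fin.ext (by omega)), fun h' => h (Fin.ext (by omega)),
        Equiv.swap_apply_of_ne_of_ne h (hd' i)⟩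
  have hs := swap_val_cases p q
  simp only [Equiv.Perm.mul_apply]
  constructor
  · intro hw
    by_cases hip : w i₀ = q
    · right
      intro i
      have h1 := hw i
      rcases hg i with ⟨h, h'⟩ | ⟨h, h', h''⟩
      · have : i = i₀ := hφ (h.trans hi₀.symm)
        subst this
        rw [h', hip, Equiv.swap_apply_right]; omega
      · rw [h'']
        rcases hs (w i) with ⟨h3, h2⟩ | ⟨h3, h2⟩ | ⟨_, _, h2⟩
        · rw [h3] at h1; omega
        · rw [h3] at h1; omega
        · rw [h2]; omega
    · left
      intro i
      have h1 := hw i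
      rcases hg i with ⟨h, h'⟩ | ⟨h, h', h''⟩
      · have : i = i₀ := hφ (h.trans hi₀.symm)
        subst this
        have : (w i : ℕ) ≠ q := fun h => hip (Fin.ext h)
        rw [h] at h1
        omega
      · rw [h'']; exact h1
  · rintro (hw | hw)
    · intro i
      have h1 := hw i
      rcases hg i with ⟨h, h'⟩ | ⟨h, h', h''⟩
      · rw [h]; omega
      · rwa [h''] at h1
    · intro i
      have h1 := hw i
      rcases hg i with ⟨h, h'⟩ | ⟨h, h', h''⟩
      · rw [h]
        rcases hs (w i) with ⟨h3, h2⟩ | ⟨h3, h2⟩ | ⟨_, _, h2⟩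
        · rw [h3]; omega
        · rw [h3]; omega
        · rw [h2] at h1; omega
      · rw [h''] at h1
        rcases hs (w i) with ⟨h3, h2⟩ | ⟨h3, h2⟩ | ⟨_, _, h2⟩
        · rw [h3]; omega
        · rw [h3]; omega
        · rw [h2] at h1; omega


/-! ### Bruhat order and principal order ideals -/

/-- `∑ i, i * w i`, which decreases strictly along the Bruhat order. -/
def moment {n : ℕ} (w : Equiv.Perm (Fin n)) : ℕ := ∑ i : Fin n, (i : ℕ) * (w i : ℕ)

theorem BruhatStep.moment_lt {n : ℕ} {u v : Equiv.Perm (Fin n)} (h : BruhatStep u v) :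
    moment v < moment u := by
  obtain ⟨i, j, hij, huij, rfl⟩ := h
  have key : ∑ k : Fin n, (((k : ℕ) : ℤ) * ((u k : ℕ) : ℤ) -
      ((k : ℕ) : ℤ) * (((u * Equiv.swap i j) k : ℕ) : ℤ)) =
      ((j : ℕ) - (i : ℕ) : ℤ) * ((u j : ℕ) - (u i : ℕ) : ℤ) := by
    rw [Fintype.sum_eq_add i j hij.ne]
    · simp only [Equiv.Perm.mul_apply, Equiv.swap_apply_left, Equiv.swap_apply_right]; ring
    · rintro k ⟨h1, h2⟩
      simp [Equiv.Perm.mul_apply, Equiv.swap_apply_of_ne_of_ne h1 h2]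
  rw [Finset.sum_sub_distrib] at key
  have hpos : (0 : ℤ) < ((j : ℕ) - (i : ℕ) : ℤ) * ((u j : ℕ) - (u i : ℕ) : ℤ) := by
    apply mul_pos
    · have : (i : ℕ) < j := hij
      omega
    · have : (u i : ℕ) < u j := huij
      omega
  simp only [Equiv.Perm.coe_mul] at key
  unfold moment
  zify
  linarith

theorem BruhatLE.moment_le {n : ℕ} {u v : Equiv.Perm (Fin n)} (h : BruhatLE u v) :
    moment v ≤ moment u := by
  induction h with
  | refl => exact le_rfl
  | tail _ h ih => exact h.moment_lt.le.trans ih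

theorem BruhatLE.antisymm {n : ℕ} {u v : Equiv.Perm (Fin n)} (h : BruhatLE u v)
    (h' : BruhatLE v u) : u = v := by
  rcases Relation.ReflTransGen.cases_head h with h | ⟨x, hux, hxv⟩
  · exact h
  · have h1 := hux.moment_lt
    have h2 := BruhatLE.moment_le hxv
    have h3 := h'.moment_le
    omega

/-- `W` is the order ideal generated by one permutation. -/
def IsPrincipal {n : ℕ} (W : Set (Equiv.Perm (Fin n))) : Prop :=
  ∃ u, ∀ x, x ∈ W ↔ BruhatLE x u

theorem IsPrincipal.exists_isUniqueMaximal {n : ℕ} {W : Set (Equiv.Perm (Fin n))}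
    (h : IsPrincipal W) : ∃ u, IsUniqueMaximal W u ∧ ∀ x, x ∈ W ↔ BruhatLE x u := by
  obtain ⟨u, hu⟩ := h
  have huW : u ∈ W := (hu u).2 Relation.ReflTransGen.refl
  refine ⟨u, fun v => ⟨fun hv => (hv.2 u huW ((hu v).1 hv.1)).symm, ?_⟩, hu⟩
  rintro rfl
  exact ⟨huW, fun x hx hvx => ((hu x).1 hx).antisymm hvx⟩

theorem IsUniqueMaximal.unique {n : ℕ} {W : Set (Equiv.Perm (Fin n))} {u v : Equiv.Perm (Fin n)}
    (hu : IsUniqueMaximal W u) (hv : IsUniqueMaximal W v) : u = v :=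
  (hv u).1 ((hu u).2 rfl)

/-- An involution that behaves with respect to Bruhat steps like the multiplication by a simple
reflection, on either side. -/
structure IsReflecting {n : ℕ} (f : Equiv.Perm (Fin n) → Equiv.Perm (Fin n)) : Prop where
  involutive : ∀ x, f (f x) = x
  comparable : ∀ x, BruhatStep x (f x) ∨ BruhatStep (f x) x
  lift : ∀ x y, BruhatStep x y → f x = y ∨ BruhatStep (f x) (f y)

/-- An adjacent transposition reverses no pair but its own; this is the source of the lifting
property on both sides. -/
theorem swap_lt_swap {n : ℕ} {p q : Fin n} (hpq : (q : ℕ) = p + 1) {i j : Fin n} (hij : i < j)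
    (hne : ¬ (i = p ∧ j = q)) : Equiv.swap p q i < Equiv.swap p q j := by
  rw [Fin.lt_def] at hij ⊢
  have hne' : ¬ ((i : ℕ) = p ∧ (j : ℕ) = q) := fun h => hne ⟨Fin.ext h.1, Fin.ext h.2⟩
  rw [Equiv.swap_apply_def, Equiv.swap_apply_def]
  split_ifs with h1 h2 h3 h4 h5 h6 h7 <;> simp only [Fin.ext_iff] at * <;> omega

theorem isReflecting_mul_swap {n : ℕ} {p q : Fin n} (hpq : (q : ℕ) = p + 1) :
    IsReflecting fun x : Equiv.Perm (Fin n) => x * Equiv.swap p q where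
  involutive x := by simp [mul_assoc]
  comparable x := by
    have hlt : p < q := by rw [Fin.lt_def]; omega
    rcases lt_or_gt_of_ne (fun h => hlt.ne (x.injective h) : x p ≠ x q) with h | h
    · exact Or.inl ⟨p, q, hlt, h, rfl⟩
    · exact Or.inr ⟨p, q, hlt, by simpa using h, by simp [mul_assoc]⟩
  lift x y := by
    rintro ⟨i, j, hij, hx, rfl⟩
    by_cases h : i = p ∧ j = q
    · left; rw [h.1, h.2]
    · right
      refine ⟨Equiv.swap p q i, Equiv.swap p q j, swap_lt_swap hpq hij h, by simpa using hx, ?_⟩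
      rw [Equiv.swap_apply_apply]
      simp [mul_assoc]

theorem isReflecting_swap_mul {n : ℕ} {p q : Fin n} (hpq : (q : ℕ) = p + 1) :
    IsReflecting fun x : Equiv.Perm (Fin n) => Equiv.swap p q * x where
  involutive x := by simp [← mul_assoc]
  comparable x := by
    have hlt : p < q := by rw [Fin.lt_def]; omega
    have hmul : Equiv.swap p q * x = x * Equiv.swap (x⁻¹ p) (x⁻¹ q) := by
      rw [Equiv.swap_apply_apply]; simp [mul_assoc]
    rcases lt_or_gt_of_ne (fun h => hlt.ne (x⁻¹.injective h) : x⁻¹ p ≠ x⁻¹ q) with h | h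
    · exact Or.inl ⟨x⁻¹ p, x⁻¹ q, h, by simpa using hlt, hmul⟩
    · refine Or.inr ⟨x⁻¹ q, x⁻¹ p, h, by simpa using hlt, ?_⟩
      rw [hmul, mul_assoc, Equiv.swap_comm (x⁻¹ q), Equiv.swap_mul_self, mul_one]
  lift x y := by
    rintro ⟨i, j, hij, hx, rfl⟩
    by_cases h : x i = p ∧ x j = q
    · left
      rw [← h.1, ← h.2, Equiv.swap_apply_apply]; simp
    · right
      exact ⟨i, j, hij, swap_lt_swap hpq hx h, (mul_assoc _ _ _).symm⟩

/-- The generator `m` is the larger of `u` and `f u`. Both directions push a Bruhat chain through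
`f` step by step: a step either survives or is the reflection itself. -/
theorem IsReflecting.exists_top {n : ℕ} {f : Equiv.Perm (Fin n) → Equiv.Perm (Fin n)}
    (hf : IsReflecting f) (u : Equiv.Perm (Fin n)) :
    ∃ m, BruhatLE u m ∧ ∀ x, BruhatLE x m ↔ BruhatLE x u ∨ BruhatLE (f x) u := by
  obtain ⟨m, hm, hum, hfm⟩ : ∃ m, (m = u ∨ m = f u) ∧ BruhatLE u m ∧ BruhatLE (f u) m := by
    rcases hf.comparable u with h | h
    · exact ⟨f u, Or.inr rfl, Relation.ReflTransGen.single h, Relation.ReflTransGen.refl⟩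
    · exact ⟨u, Or.inl rfl, Relation.ReflTransGen.refl, Relation.ReflTransGen.single h⟩
  have hup : ∀ x, BruhatLE x u → BruhatLE (f x) m := by
    intro x hx
    induction hx using Relation.ReflTransGen.head_induction_on with
    | refl => exact hfm
    | head hxy hyu ih =>
      rcases hf.lift _ _ hxy with h | h
      · rw [h]; exact hyu.trans hum
      · exact Relation.ReflTransGen.head h ih
  refine ⟨m, hum, fun x => ⟨fun hx => ?_, ?_⟩⟩
  · induction hx using Relation.ReflTransGen.head_induction_on with
    | refl =>
      rcases hm with rfl | rfl
      · exact Or.inl Relation.ReflTransGen.refl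
      · right; rw [hf.involutive]; exact Relation.ReflTransGen.refl
    | head hxy _ ih =>
      rcases ih with ih | ih
      · exact Or.inl (Relation.ReflTransGen.head hxy ih)
      · rcases hf.lift _ _ hxy with h | h
        · left; rw [← h, hf.involutive] at ih; exact ih
        · exact Or.inr (Relation.ReflTransGen.head h ih)
  · rintro (h | h)
    · exact h.trans hum
    · have := hup _ h
      rwa [hf.involutive] at this

theorem IsPrincipal.of_isReflecting {n : ℕ} {W V : Set (Equiv.Perm (Fin n))}
    {f : Equiv.Perm (Fin n) → Equiv.Perm (Fin n)} (hf : IsReflecting f) (hW : IsPrincipal W)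
    (hV : ∀ x, x ∈ V ↔ x ∈ W ∨ f x ∈ W) : IsPrincipal V := by
  obtain ⟨u, hu⟩ := hW
  obtain ⟨m, -, hm⟩ := hf.exists_top u
  exact ⟨m, fun x => by rw [hV, hm, hu, hu]⟩

theorem exists_descent {n : ℕ} {w : Equiv.Perm (Fin n)} (hw : w ≠ 1) :
    ∃ p q : Fin n, (q : ℕ) = p + 1 ∧ w q < w p := by
  by_contra! hcon
  apply hw
  cases n with
  | zero => exact Subsingleton.elim _ _
  | succ n =>
    have hmono : StrictMono w := by
      rw [Fin.strictMono_iff_lt_succ]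
      intro i
      refine lt_of_le_of_ne (hcon i.castSucc i.succ (by simp)) fun h => ?_
      exact (Fin.castSucc_lt_succ (i := i)).ne (w.injective h)
    have : (hmono.orderIsoOfSurjective w w.surjective : Fin (n + 1) ≃o Fin (n + 1)) =
        OrderIso.refl _ := Subsingleton.elim _ _
    ext i
    exact congrArg (fun e : Fin (n + 1) ≃o Fin (n + 1) => ((e i : Fin (n + 1)) : ℕ)) this

/-- The permutations preserving an initial segment form a principal order ideal. -/
theorem isPrincipal_preserving {n : ℕ} (k : ℕ) :
    IsPrincipal {w : Equiv.Perm (Fin n) | ∀ i, (w i : ℕ) < k ↔ (i : ℕ) < k} := by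
  set H := {w : Equiv.Perm (Fin n) | ∀ i, (w i : ℕ) < k ↔ (i : ℕ) < k} with hH
  -- The generator is sought among permutations whose whole lower ideal stays in `H`; least `moment`
  -- makes it Bruhat-maximal among them.
  let P : Set (Equiv.Perm (Fin n)) := {v | BruhatLE 1 v ∧ ∀ x, BruhatLE x v → x ∈ H}
  have hone : (1 : Equiv.Perm (Fin n)) ∈ P := by
    refine ⟨Relation.ReflTransGen.refl, fun x hx => ?_⟩
    rcases Relation.ReflTransGen.cases_tail hx with h | ⟨y, -, i, j, hij, hy, h⟩
    · intro i; rw [← h]; rfl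
    · have : y = Equiv.swap i j := by
        rw [mul_eq_one_iff_eq_inv.1 h.symm, Equiv.swap_inv]
      subst this
      simp only [Equiv.swap_apply_left, Equiv.swap_apply_right] at hy
      exact absurd hij hy.asymm
  obtain ⟨v, hv, hmin⟩ := Set.exists_min_image P moment (Set.toFinite P) ⟨1, hone⟩
  have hclosed : ∀ p q : Fin n, (q : ℕ) = p + 1 → (q : ℕ) ≠ k → ∀ x, BruhatLE x v →
      BruhatLE (x * Equiv.swap p q) v := by
    intro p q hpq hqk x hx
    have hf := isReflecting_mul_swap hpq
    obtain ⟨m, hvm, hm⟩ := hf.exists_top v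
    have hmP : m ∈ P := by
      refine ⟨hv.1.trans hvm, fun y hy => ?_⟩
      rcases (hm y).1 hy with h | h
      · exact hv.2 y h
      · intro i
        have h1 := hv.2 _ h (Equiv.swap p q i)
        simp only [Equiv.Perm.mul_apply, Equiv.swap_apply_self] at h1
        rw [h1, Equiv.swap_apply_def]
        split_ifs with h2 h3
        · rw [h2]; omega
        · rw [h3]; omega
        · rfl
    have hmv : m = v := by
      rcases Relation.ReflTransGen.cases_head hvm with h | ⟨y, hvy, hym⟩
      · exact h.symm
      · have h1 := hvy.moment_lt
        have h2 := BruhatLE.moment_le hym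
        have h3 := hmin m hmP
        omega
    rw [← hmv]
    exact (hm _).2 (Or.inr (by simpa [mul_assoc] using hx))
  refine ⟨v, fun x => ⟨fun hx => ?_, hv.2 x⟩⟩
  by_contra hcon
  -- A counterexample of largest `moment`: removing a descent raises `moment`, so the result lies
  -- below `v`, and `hclosed` brings `y` back below `v`.
  obtain ⟨y, ⟨hyH, hyv⟩, hmax⟩ := Set.exists_max_image {y | y ∈ H ∧ ¬ BruhatLE y v} moment
    (Set.toFinite _) ⟨x, hx, hcon⟩
  obtain ⟨p, q, hpq, hlt⟩ := exists_descent (w := y) (by rintro rfl; exact hyv hv.1)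
  -- A permutation in `H` has no descent across the cut at `k`.
  have hqk : (q : ℕ) ≠ k := by
    intro h
    have h1 := (hyH p).2 (by omega)
    have h2 := mt (hyH q).1 (by omega)
    rw [Fin.lt_def] at hlt
    omega
  have hstep : BruhatStep (y * Equiv.swap p q) y :=
    ⟨p, q, by rw [Fin.lt_def]; omega, by simpa using hlt, by simp [mul_assoc]⟩
  have hzH : y * Equiv.swap p q ∈ H := by
    intro i
    rw [Equiv.Perm.mul_apply, hyH, Equiv.swap_apply_def]
    split_ifs with h2 h3
    · rw [h2]; omega
    · rw [h3]; omega
    · rfl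
  by_cases hz : BruhatLE (y * Equiv.swap p q) v
  · apply hyv
    simpa [mul_assoc] using hclosed p q hpq hqk _ hz
  · have h1 := hmax _ ⟨hzH, hz⟩
    have h2 := hstep.moment_lt
    omega


/-! ### Permutations with a given basis form a principal ideal -/

/-- The total distance of the elements of `J` to the two ends of `[2n]`. -/
def endDistance {n : ℕ} (J : Finset (Fin (2 * n))) : ℕ :=
  ∑ c ∈ J, if (c : ℕ) < n then (c : ℕ) else 2 * n - c

theorem endDistance_image_swap_lt {n : ℕ} {J : Finset (Fin (2 * n))} {c d : Fin (2 * n)}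
    (hc : c ∈ J) (hd : d ∉ J)
    (h : (if (d : ℕ) < n then (d : ℕ) else 2 * n - d) <
      if (c : ℕ) < n then (c : ℕ) else 2 * n - c) :
    endDistance (J.image (Equiv.swap c d)) < endDistance J := by
  unfold endDistance
  rw [Finset.sum_image fun a _ b _ hab => (Equiv.swap c d).injective hab]
  have hne : ∀ x ∈ J, x ≠ c → Equiv.swap c d x = x := fun x hx hxc =>
    Equiv.swap_apply_of_ne_of_ne hxc fun hxd => hd (hxd ▸ hx)
  refine Finset.sum_lt_sum (fun x hx => ?_) ⟨c, hc, by rwa [Equiv.swap_apply_left]⟩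
  by_cases hxc : x = c
  · rw [hxc, Equiv.swap_apply_left]; exact h.le
  · rw [hne x hx hxc]

theorem exists_val_eq_of_lt {m : ℕ} (k : ℕ) (hk : k < m) :
    ∃ c : Fin m, (c : ℕ) = k := ⟨⟨k, hk⟩, rfl⟩

/-- The base case: a union of an initial and a final segment. -/
theorem isPrincipal_permsOf_of_closed {n : ℕ} {J : Finset (Fin (2 * n))} (hJ : J.card = n)
    (hlow : ∀ c d : Fin (2 * n), (c : ℕ) < n → (c : ℕ) = d + 1 → c ∈ J → d ∈ J)
    (hhigh : ∀ c d : Fin (2 * n), n ≤ (c : ℕ) → (d : ℕ) = c + 1 → c ∈ J → d ∈ J) :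
    IsPrincipal (permsOf J) := by
  have hlow' : ∀ m : ℕ, ∀ c d : Fin (2 * n), (c : ℕ) < n → (c : ℕ) = d + m → c ∈ J → d ∈ J := by
    intro m
    induction m with
    | zero => intro c d _ h hcJ; rwa [show d = c from Fin.ext (by omega)]
    | succ m ih =>
      intro c d hc h hcJ
      obtain ⟨e, he⟩ := exists_val_eq_of_lt (m := 2 * n) (d + m) (by omega)
      exact ih e d (by omega) he (hlow c e hc (by omega) hcJ)
  have hhigh' : ∀ m : ℕ, ∀ c d : Fin (2 * n), n ≤ (c : ℕ) → (d : ℕ) = c + m → c ∈ J → d ∈ J := by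
    intro m
    induction m with
    | zero => intro c d _ h hcJ; rwa [show d = c from Fin.ext (by omega)]
    | succ m ih =>
      intro c d hc h hcJ
      have := d.isLt
      obtain ⟨e, he⟩ := exists_val_eq_of_lt (m := 2 * n) (c + 1) (by omega)
      exact ih e d (by omega) (by omega) (hhigh c e hc (by omega) hcJ)
  obtain ⟨k, hk⟩ : ∃ k, k = (J.filter fun c : Fin (2 * n) => (c : ℕ) < n).card := ⟨_, rfl⟩
  have hk' : n - k = (J.filter fun c : Fin (2 * n) => ¬ (c : ℕ) < n).card := by
    have := Finset.card_filter_add_card_filter_not (s := J) fun c : Fin (2 * n) => (c : ℕ) < n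
    omega
  have hkn : k ≤ n := by
    exact hk.trans_le ((Finset.card_filter_le _ _).trans hJ.le)
  have hcard : ∀ (A : Finset (Fin (2 * n))) (a b : ℕ), (∀ c ∈ A, a ≤ (c : ℕ) ∧ (c : ℕ) < b) →
      A.card ≤ b - a := by
    intro A a b h
    rw [← Nat.card_Ico]
    refine Finset.card_le_card_of_injOn (fun c => (c : ℕ)) (fun c hc => ?_)
      (fun c _ d _ h => Fin.ext h)
    have := h c hc
    simpa using this
  have hcard' : ∀ (A : Finset (Fin (2 * n))) (a b : ℕ), b ≤ 2 * n →
      (∀ c : Fin (2 * n), a ≤ (c : ℕ) → (c : ℕ) < b → c ∈ A) → b - a ≤ A.card := by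
    intro A a b hb h
    have : (Finset.Ico a b) ⊆ A.image fun c : Fin (2 * n) => (c : ℕ) := by
      intro x hx
      rw [Finset.mem_Ico] at hx
      exact Finset.mem_image.2 ⟨⟨x, by omega⟩, h _ hx.1 hx.2, rfl⟩
    have := (Finset.card_le_card this).trans Finset.card_image_le
    rwa [Nat.card_Ico] at this
  -- A low column in `J` brings all columns to its left, a high one all to its right; counting each
  -- half confines `J` to a set of at most `n` columns.
  have hmem : ∀ c : Fin (2 * n), c ∈ J ↔ (c : ℕ) < k ∨ n + k ≤ c := by
    have h1 : ∀ c : Fin (2 * n), c ∈ J → (c : ℕ) < n → (c : ℕ) < k := by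
      intro c hc hcn
      have := hcard' (J.filter fun c : Fin (2 * n) => (c : ℕ) < n) 0 (c + 1) (by omega) fun d _ hd => by
        rw [Finset.mem_filter]
        exact ⟨hlow' (c - d) c d hcn (by omega) hc, by omega⟩
      omega
    have h2 : ∀ c : Fin (2 * n), c ∈ J → n ≤ (c : ℕ) → n + k ≤ (c : ℕ) := by
      intro c hc hcn
      have hc2 := c.isLt
      have := hcard' (J.filter fun c : Fin (2 * n) => ¬ (c : ℕ) < n) c (2 * n) le_rfl fun d hd _ => by
        rw [Finset.mem_filter]
        exact ⟨hhigh' (d - c) c d hcn (by omega) hc, by omega⟩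
      omega
    have hsub : J ⊆ univ.filter fun c : Fin (2 * n) => (c : ℕ) < k ∨ n + k ≤ c := by
      intro c hc
      rw [Finset.mem_filter]
      refine ⟨mem_univ _, ?_⟩
      rcases lt_or_ge (c : ℕ) n with h | h
      · exact Or.inl (h1 c hc h)
      · exact Or.inr (h2 c hc h)
    have heq := Finset.eq_of_subset_of_card_le hsub (by
      rw [Finset.filter_or]
      refine (Finset.card_union_le _ _).trans ?_
      have h3 := hcard (univ.filter fun c : Fin (2 * n) => (c : ℕ) < k) 0 k fun c hc => by
        rw [Finset.mem_filter] at hc; omega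
      have h4 := hcard (univ.filter fun c : Fin (2 * n) => n + k ≤ (c : ℕ)) (n + k) (2 * n)
        fun c hc => by rw [Finset.mem_filter] at hc; omega
      omega)
    intro c
    rw [heq, Finset.mem_filter]
    simp
  obtain ⟨u, hu⟩ := isPrincipal_preserving (n := n) k
  refine ⟨u, fun w => ?_⟩
  rw [← hu]
  change w ∈ permsOf J ↔ ∀ i : Fin n, (w i : ℕ) < k ↔ (i : ℕ) < k
  change J ∈ bases w ↔ _
  rw [mem_bases_iff]
  constructor
  · rintro ⟨φ, hφ, him, hw⟩
    have hφJ : ∀ i, φ i ∈ J := fun i => by rw [← him]; simp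
    -- Row `i < k` ends before column `n + k`, so its matched column, and hence `w i`, is below `k`.
    have hmaps : ∀ i : Fin n, (i : ℕ) < k → (w i : ℕ) < k := by
      intro i hi
      have h1 := hw i
      rcases (hmem _).1 (hφJ i) with h | h <;> omega
    have hsub : (univ.filter fun i : Fin n => (i : ℕ) < k).image w ⊆
        univ.filter fun i : Fin n => (i : ℕ) < k := by
      intro i hi
      obtain ⟨j, hj, rfl⟩ := Finset.mem_image.1 hi
      rw [Finset.mem_filter] at hj ⊢
      exact ⟨mem_univ _, hmaps j hj.2⟩
    have heq := Finset.eq_of_subset_of_card_le hsub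
      (Finset.card_image_of_injective _ w.injective).ge
    refine fun i => ⟨fun hi => ?_, hmaps i⟩
    have : w i ∈ (univ.filter fun i : Fin n => (i : ℕ) < k).image w := by
      rw [heq, Finset.mem_filter]; exact ⟨mem_univ _, hi⟩
    obtain ⟨j, hj, hji⟩ := Finset.mem_image.1 this
    rw [← w.injective hji]
    exact (Finset.mem_filter.1 hj).2
  · intro hw
    -- The first `k` rows take their leftmost column, the others their rightmost.
    let φ : Fin n → Fin (2 * n) := fun i =>
      if (i : ℕ) < k then ⟨w i, by omega⟩ else ⟨i + n, by omega⟩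
    have hφ1 : ∀ i : Fin n, (i : ℕ) < k → (φ i : ℕ) = w i := fun i hi => by simp [φ, hi]
    have hφ2 : ∀ i : Fin n, ¬ (i : ℕ) < k → (φ i : ℕ) = i + n := fun i hi => by simp [φ, hi]
    have hinj : Function.Injective φ := by
      intro i j hij
      have hij' : (φ i : ℕ) = φ j := by rw [hij]
      by_cases hi : (i : ℕ) < k <;> by_cases hj : (j : ℕ) < k
      · rw [hφ1 i hi, hφ1 j hj] at hij'
        exact w.injective (Fin.ext hij')
      · rw [hφ1 i hi, hφ2 j hj] at hij'; omega
      · rw [hφ2 i hi, hφ1 j hj] at hij'; omega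
      · rw [hφ2 i hi, hφ2 j hj] at hij'; exact Fin.ext (by omega)
    refine ⟨φ, hinj, ?_, fun i => ?_⟩
    · refine Finset.eq_of_subset_of_card_le (fun c hc => ?_) ?_
      · obtain ⟨i, -, rfl⟩ := Finset.mem_image.1 hc
        rw [hmem]
        by_cases hi : (i : ℕ) < k
        · rw [hφ1 i hi]; exact Or.inl ((hw i).2 hi)
        · rw [hφ2 i hi]; exact Or.inr (by omega)
      · rw [Finset.card_image_of_injective _ hinj, hJ]; simp
    · by_cases hi : (i : ℕ) < k
      · rw [hφ1 i hi]; omega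
      · rw [hφ2 i hi]; omega

theorem isPrincipal_permsOf {n : ℕ} (J : Finset (Fin (2 * n))) (hJ : J.card = n) :
    IsPrincipal (permsOf J) := by
  induction hm : endDistance J using Nat.strong_induction_on generalizing J with
  | _ m ih =>
  subst hm
  have hcard : ∀ c d : Fin (2 * n), (J.image (Equiv.swap c d)).card = n := fun c d => by
    rw [Finset.card_image_of_injective _ (Equiv.swap c d).injective, hJ]
  by_cases hlow : ∀ c d : Fin (2 * n), (c : ℕ) < n → (c : ℕ) = d + 1 → c ∈ J → d ∈ J
  · by_cases hhigh : ∀ c d : Fin (2 * n), n ≤ (c : ℕ) → (d : ℕ) = c + 1 → c ∈ J → d ∈ J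
    · exact isPrincipal_permsOf_of_closed hJ hlow hhigh
    · push Not at hhigh
      obtain ⟨c, d, hc, hcd, hcJ, hdJ⟩ := hhigh
      have hd := d.isLt
      obtain ⟨p, hp⟩ := exists_val_eq_of_lt (m := n) (c - n) (by omega)
      obtain ⟨q, hq⟩ := exists_val_eq_of_lt (m := n) (p + 1) (by omega)
      refine (ih _ (endDistance_image_swap_lt hcJ hdJ ?_) _ (hcard c d) rfl).of_isReflecting
        (isReflecting_mul_swap hq) fun w =>
        mem_bases_iff_of_row_swap w hq (by omega) (by omega) hcJ hdJ
      rw [if_neg (by omega), if_neg (by omega)]; omega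
  · push Not at hlow
    obtain ⟨c, d, hc, hcd, hcJ, hdJ⟩ := hlow
    obtain ⟨p, hp⟩ := exists_val_eq_of_lt (m := n) d (by omega)
    obtain ⟨q, hq⟩ := exists_val_eq_of_lt (m := n) (p + 1) (by omega)
    refine (ih _ (endDistance_image_swap_lt hcJ hdJ ?_) _ (hcard c d) rfl).of_isReflecting
      (isReflecting_swap_mul hq) fun w =>
      mem_bases_iff_of_value_swap w hq (by omega) (by omega) hcJ hdJ
    rw [if_pos (by omega), if_pos (by omega)]; omega


/-! ### The order `≺` and its initial segments -/

theorem position_injective {n : ℕ} : Function.Injective (position (n := n)) := by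
  intro a b h
  unfold position at h
  apply Fin.ext
  split_ifs at h <;> omega

theorem position_lt {n : ℕ} (c : Fin (2 * n)) : position c < 2 * n := by
  unfold position
  split_ifs <;> omega

theorem firstElems_subset {n : ℕ} (k : ℕ) (A : Finset (Fin (2 * n))) : firstElems k A ⊆ A :=
  Finset.filter_subset _ _

theorem mem_firstElems_of_prec {n : ℕ} {k : ℕ} {A : Finset (Fin (2 * n))} {x y : Fin (2 * n)}
    (hx : x ∈ A) (hy : y ∈ firstElems k A) (hxy : Prec x y) : x ∈ firstElems k A := by
  unfold firstElems at hy ⊢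
  rw [Finset.mem_filter] at hy ⊢
  refine ⟨hx, lt_of_le_of_lt (Finset.card_le_card fun z hz => ?_) hy.2⟩
  rw [Finset.mem_filter] at hz ⊢
  exact ⟨hz.1, lt_trans (show position z < position x from hz.2) hxy⟩

/-- Counting predecessors numbers the elements of `A` bijectively from `0` to `A.card - 1`. -/
theorem card_firstElems {n : ℕ} {k : ℕ} {A : Finset (Fin (2 * n))} (hk : k ≤ A.card) :
    (firstElems k A).card = k := by
  set f : Fin (2 * n) → ℕ := fun x => (A.filter fun y => Prec y x).card with hf
  have hlt : ∀ x ∈ A, ∀ y, Prec x y → f x < f y := by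
    intro x hx y hxy
    refine Finset.card_lt_card (Finset.ssubset_iff_of_subset (fun z hz => ?_) |>.2 ⟨x, ?_, ?_⟩)
    · rw [Finset.mem_filter] at hz ⊢
      exact ⟨hz.1, lt_trans (show position z < position x from hz.2) hxy⟩
    · exact Finset.mem_filter.2 ⟨hx, hxy⟩
    · exact fun h => lt_irrefl (position x) (Finset.mem_filter.1 h).2
  have hinj : Set.InjOn f A := by
    intro x hx y hy hxy
    by_contra hne
    rcases lt_or_gt_of_ne (fun h => hne (position_injective h)) with h | h
    · exact (hlt x hx y h).ne hxy
    · exact (hlt y hy x h).ne hxy.symm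
  have himage : A.image f = range A.card := by
    refine Finset.eq_of_subset_of_card_le (fun m hm => ?_) ?_
    · obtain ⟨x, hx, rfl⟩ := Finset.mem_image.1 hm
      rw [Finset.mem_range]
      exact Finset.card_lt_card (Finset.filter_ssubset.2 ⟨x, hx, lt_irrefl (position x)⟩)
    · rw [Finset.card_image_of_injOn hinj, Finset.card_range]
  have himage' : (firstElems k A).image f = range k := by
    ext m
    rw [Finset.mem_image, Finset.mem_range]
    constructor
    · rintro ⟨x, hx, rfl⟩
      exact (Finset.mem_filter.1 hx).2
    · intro hm
      have : m ∈ A.image f := by rw [himage, Finset.mem_range]; omega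
      obtain ⟨x, hx, rfl⟩ := Finset.mem_image.1 this
      exact ⟨x, Finset.mem_filter.2 ⟨hx, hm⟩, rfl⟩
  rw [← Finset.card_image_of_injOn (hinj.mono (firstElems_subset k A)), himage',
    Finset.card_range]

theorem card_filter_position_lt {n : ℕ} {p : ℕ} (hp : p ≤ 2 * n) :
    (univ.filter fun c : Fin (2 * n) => position c < p).card = p := by
  have himage : univ.image (position (n := n)) = range (2 * n) := by
    refine Finset.eq_of_subset_of_card_le (fun m hm => ?_) ?_
    · obtain ⟨x, -, rfl⟩ := Finset.mem_image.1 hm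
      exact Finset.mem_range.2 (position_lt x)
    · rw [Finset.card_image_of_injective _ position_injective]; simp
  have : (univ.filter fun c : Fin (2 * n) => position c < p).image position = range p := by
    ext m
    rw [Finset.mem_image, Finset.mem_range]
    constructor
    · rintro ⟨x, hx, rfl⟩
      exact (Finset.mem_filter.1 hx).2
    · intro hm
      have : m ∈ univ.image (position (n := n)) := by rw [himage, Finset.mem_range]; omega
      obtain ⟨x, -, rfl⟩ := Finset.mem_image.1 this
      exact ⟨x, Finset.mem_filter.2 ⟨mem_univ _, hm⟩, rfl⟩
  rw [← Finset.card_image_of_injective _ position_injective, this, Finset.card_range]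

/-! ### Lexicographic minimality of `J_r(I)` -/

section LexSet

variable {n r : ℕ} {I : Finset (Fin (2 * n))}

theorem disjoint_firstElems :
    Disjoint (firstElems r I) (firstElems (n - r) (univ \ firstElems r I)) :=
  Finset.disjoint_of_subset_right (firstElems_subset _ _) Finset.disjoint_sdiff

theorem card_firstElems_compl (hrI : r ≤ I.card) :
    (firstElems (n - r) (univ \ firstElems r I)).card = n - r := by
  apply card_firstElems
  rw [Finset.card_univ_sdiff, card_firstElems hrI, Fintype.card_fin]
  omega

theorem card_lexSet (hrn : r ≤ n) (hrI : r ≤ I.card) : (lexSet r I).card = n := by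
  unfold lexSet
  rw [Finset.card_union_of_disjoint disjoint_firstElems, card_firstElems hrI,
    card_firstElems_compl hrI]
  omega

theorem le_card_lexSet_inter (hrI : r ≤ I.card) : r ≤ (lexSet r I ∩ I).card := by
  calc r = (firstElems r I).card := (card_firstElems hrI).symm
    _ ≤ _ := Finset.card_le_card
      (Finset.subset_inter Finset.subset_union_left (firstElems_subset _ _))

theorem mem_lexSet_of_prec {x g : Fin (2 * n)}
    (hg : g ∈ firstElems (n - r) (univ \ firstElems r I)) (hxg : Prec x g) : x ∈ lexSet r I := by
  by_cases hx : x ∈ firstElems r I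
  · exact Finset.mem_union_left _ hx
  · exact Finset.mem_union_right _
      (mem_firstElems_of_prec (Finset.mem_sdiff.2 ⟨mem_univ _, hx⟩) hg hxg)

theorem isLexSmallest_lexSet (hrn : r ≤ n) (hrI : r ≤ I.card) :
    IsLexSmallest r I (lexSet r I) := by
  refine ⟨⟨card_lexSet hrn hrI, le_card_lexSet_inter hrI⟩, fun K hK hKI hne => ?_⟩
  set J := lexSet r I with hJ
  set F := firstElems r I with hF
  set G := firstElems (n - r) (univ \ F) with hG
  have hJFG : J = F ∪ G := rfl
  have hJcard : J.card = n := card_lexSet hrn hrI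
  have hdiff : (univ.filter fun x => ¬ (x ∈ J ↔ x ∈ K)).Nonempty := by
    by_contra h
    rw [Finset.not_nonempty_iff_eq_empty, Finset.filter_eq_empty_iff] at h
    exact hne (Finset.ext fun x => (not_not.1 (h (mem_univ x))).symm)
  obtain ⟨a, ha, hmin⟩ := Finset.exists_min_image _ position hdiff
  have hbefore : ∀ x, Prec x a → (x ∈ J ↔ x ∈ K) := by
    intro x hx
    by_contra h
    exact absurd (hmin x (Finset.mem_filter.2 ⟨mem_univ _, h⟩)) (not_le.2 hx)
  have ha' := (Finset.mem_filter.1 ha).2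
  by_cases haJ : a ∈ J
  · exact ⟨a, haJ, fun haK => ha' ⟨fun _ => haK, fun _ => haJ⟩, hbefore⟩
  exfalso
  have haK : a ∈ K := by
    by_contra h
    exact ha' ⟨fun h' => absurd h' haJ, fun h' => absurd h' h⟩
  have hprec : ∀ x ∈ J, ¬ Prec a x → Prec x a := fun x hx h =>
    lt_of_le_of_ne (not_lt.1 h) fun h' => haJ (position_injective h' ▸ hx)
  -- Everything before a filler element lies in `J`, so `a`, which does not, comes after all of
  -- them.
  have hGa : ∀ g ∈ G, Prec g a := fun g hg =>
    hprec g (Finset.mem_union_right _ hg) fun h => haJ (mem_lexSet_of_prec hg h)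
  have hGK : G ⊆ K := fun g hg => (hbefore g (hGa g hg)).1 (Finset.mem_union_right _ hg)
  obtain ⟨f, hfF, haf⟩ : ∃ f ∈ F, Prec a f := by
    by_contra! hcon
    have hFK : F ⊆ K := fun f hf =>
      (hbefore f (hprec f (Finset.mem_union_left _ hf) (hcon f hf))).1 (Finset.mem_union_left _ hf)
    have hJK : J = K := Finset.eq_of_subset_of_card_le (Finset.union_subset hFK hGK) (by omega)
    exact hne hJK.symm
  have hnotI : ∀ x, x ∉ F → Prec x f → x ∉ I := fun x hxF hxf hxI =>
    hxF (mem_firstElems_of_prec hxI hfF hxf)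
  have haF : a ∉ F := fun h => haJ (Finset.mem_union_left _ h)
  have haG : a ∉ G := fun h => haJ (Finset.mem_union_right _ h)
  have hGF : ∀ g ∈ G, g ∉ F := fun g hg hgF =>
    (Finset.disjoint_left.1 disjoint_firstElems) hgF hg
  -- The `n - r + 1` elements of `insert a G` lie in `K`, and all precede `f` without being in `F`,
  -- hence avoid `I`. So `K` meets `I` in fewer than `r` elements.
  have hsub : K ∩ I ⊆ K \ insert a G := by
    intro x hx
    rw [Finset.mem_inter] at hx
    rw [Finset.mem_sdiff, Finset.mem_insert]
    refine ⟨hx.1, ?_⟩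
    rintro (rfl | hxG)
    · exact hnotI x haF haf hx.2
    · exact hnotI x (hGF x hxG) (lt_trans (hGa x hxG) haf) hx.2
  have h1 := Finset.card_le_card hsub
  have hGc : G.card = n - r := card_firstElems_compl hrI
  have hins : insert a G ⊆ K := Finset.insert_subset haK hGK
  rw [Finset.card_sdiff_of_subset hins, Finset.card_insert_of_notMem haG] at h1
  have h2 := Finset.card_le_card hins
  rw [Finset.card_insert_of_notMem haG] at h2
  omega

end LexSet

/-! ### Rank and bases -/

/-- The rows whose entry in column `c` of the generic matrix is nonzero. -/
def rowSupport {n : ℕ} (w : Equiv.Perm (Fin n)) (c : Fin (2 * n)) : Finset (Fin n) :=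
  univ.filter fun i => (w i : ℕ) ≤ c ∧ (c : ℕ) ≤ i + n

theorem mem_rowSupport {n : ℕ} {w : Equiv.Perm (Fin n)} {c : Fin (2 * n)} {i : Fin n} :
    i ∈ rowSupport w c ↔ (w i : ℕ) ≤ c ∧ (c : ℕ) ≤ i + n := by
  simp [rowSupport]

theorem mem_bases_of_hall {n : ℕ} {w : Equiv.Perm (Fin n)} {J : Finset (Fin (2 * n))}
    (hJ : J.card = n) (h : ∀ S ⊆ J, S.card ≤ (S.biUnion (rowSupport w)).card) :
    J ∈ bases w := by
  obtain ⟨f, hf, hfw⟩ := (Finset.all_card_le_biUnion_card_iff_exists_injective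
    fun c : J => rowSupport w c).1 fun S => by
      have := h (S.map (Function.Embedding.subtype _)) fun c hc => by
        obtain ⟨d, -, rfl⟩ := Finset.mem_map.1 hc
        exact d.2
      rw [Finset.card_map, Finset.map_eq_image, Finset.image_biUnion] at this
      exact this
  have hbij : Function.Bijective f :=
    (Fintype.bijective_iff_injective_and_card f).2 ⟨hf, by simp [hJ]⟩
  let e := Equiv.ofBijective f hbij
  rw [mem_bases_iff]
  refine ⟨fun i => (e.symm i : Fin (2 * n)), Subtype.val_injective.comp e.symm.injective, ?_,
    fun i => ?_⟩
  · ext c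
    simp only [Finset.mem_image, mem_univ, true_and]
    constructor
    · rintro ⟨i, rfl⟩; exact (e.symm i).2
    · intro hc; exact ⟨e ⟨c, hc⟩, by simp⟩
  · have h1 := hfw (e.symm i)
    rw [mem_rowSupport] at h1
    have h2 : f (e.symm i) = i := e.apply_symm_apply i
    rwa [h2] at h1

/-- A high column `c` meets every row `i ≥ c - n`; a low one meets every row with `w i ≤ c`. -/
theorem card_rowSupport_ge {n : ℕ} (w : Equiv.Perm (Fin n)) (c : Fin (2 * n)) :
    n - position c / 2 ≤ (rowSupport w c).card := by
  unfold position
  split_ifs with hc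
  · have : (Finset.Ico ((c : ℕ) - n) n) ⊆ (rowSupport w c).image fun i : Fin n => (i : ℕ) := by
      intro x hx
      rw [Finset.mem_Ico] at hx
      refine Finset.mem_image.2 ⟨⟨x, hx.2⟩, mem_rowSupport.2 ?_, rfl⟩
      have := (w ⟨x, hx.2⟩).isLt
      dsimp only
      omega
    have := (Finset.card_le_card this).trans Finset.card_image_le
    rw [Nat.card_Ico] at this
    omega
  · have : (Finset.range ((c : ℕ) + 1)) ⊆ (rowSupport w c).image fun i => (w i : ℕ) := by
      intro x hx
      rw [Finset.mem_range] at hx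
      refine Finset.mem_image.2 ⟨w⁻¹ ⟨x, by omega⟩, mem_rowSupport.2 ?_, by simp⟩
      rw [show ∀ j, w (w⁻¹ j) = j from w.apply_symm_apply]
      dsimp only
      omega
    have := (Finset.card_le_card this).trans Finset.card_image_le
    rw [Finset.card_range] at this
    omega

/-- Column `c` is matched with the row `w⁻¹ c`, where it is leftmost. -/
theorem card_le_card_biUnion_rowSupport_of_low {n : ℕ} (w : Equiv.Perm (Fin n))
    {S : Finset (Fin (2 * n))} (hS : ∀ c ∈ S, (c : ℕ) < n) :
    S.card ≤ (S.biUnion (rowSupport w)).card := by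
  have : S ⊆ (S.biUnion (rowSupport w)).image
      fun i => (⟨w i, by omega⟩ : Fin (2 * n)) := by
    intro c hc
    have hcn := hS c hc
    refine Finset.mem_image.2 ⟨w⁻¹ ⟨c, hcn⟩,
      Finset.mem_biUnion.2 ⟨c, hc, mem_rowSupport.2 ?_⟩, by simp⟩
    rw [show ∀ j, w (w⁻¹ j) = j from w.apply_symm_apply]
    dsimp only
    omega
  exact (Finset.card_le_card this).trans Finset.card_image_le

theorem card_le_card_biUnion_rowSupport_of_high {n : ℕ} (w : Equiv.Perm (Fin n))
    {S : Finset (Fin (2 * n))} (hS : ∀ c ∈ S, n ≤ (c : ℕ)) :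
    S.card ≤ (S.biUnion (rowSupport w)).card := by
  have : S ⊆ (S.biUnion (rowSupport w)).image
      fun i : Fin n => (⟨i + n, by omega⟩ : Fin (2 * n)) := by
    intro c hc
    have hcn := hS c hc
    have hi : (c : ℕ) - n < n := by omega
    refine Finset.mem_image.2 ⟨⟨(c : ℕ) - n, hi⟩,
      Finset.mem_biUnion.2 ⟨c, hc, mem_rowSupport.2 ?_⟩, Fin.ext ?_⟩
    · have := (w ⟨(c : ℕ) - n, hi⟩).isLt
      dsimp only
      omega
    · dsimp only; omega
  exact (Finset.card_le_card this).trans Finset.card_image_le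

/-- In each half only one end of the row intervals constrains membership, so supports are nested,
shrinking away from the middle. -/
theorem rowSupport_subset_or_prec {n : ℕ} (w : Equiv.Perm (Fin n)) {x s : Fin (2 * n)}
    (h : (x : ℕ) < n ↔ (s : ℕ) < n) : rowSupport w x ⊆ rowSupport w s ∨ Prec x s := by
  by_cases hp : Prec x s
  · exact Or.inr hp
  left
  intro i hi
  rw [mem_rowSupport] at hi ⊢
  have := (w i).isLt
  unfold Prec position at hp
  split_ifs at hp <;> omega

/-- The Hall condition for the first `r` elements of a set of rank at least `r`. -/
theorem card_le_card_biUnion_of_subset_firstElems {n r : ℕ} {w : Equiv.Perm (Fin n)}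
    {I K S : Finset (Fin (2 * n))} (hrI : r ≤ I.card) (hK : K ∈ bases w)
    (hKI : r ≤ (I ∩ K).card) (hS : S ⊆ firstElems r I) :
    S.card ≤ (S.biUnion (rowSupport w)).card := by
  by_contra! hlt
  set N := S.biUnion (rowSupport w) with hN
  set F := firstElems r I with hF
  -- A violating set has columns in both halves, so every column can be compared with an element of
  -- `S` in its own half.
  obtain ⟨s, hs, hsn⟩ : ∃ s ∈ S, (s : ℕ) < n := by
    by_contra! hcon
    exact absurd (card_le_card_biUnion_rowSupport_of_high w hcon) (not_le.2 hlt)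
  obtain ⟨t, ht, htn⟩ : ∃ t ∈ S, n ≤ (t : ℕ) := by
    by_contra! hcon
    exact absurd (card_le_card_biUnion_rowSupport_of_low w hcon) (not_le.2 hlt)
  let D : Fin (2 * n) → Prop := fun c => rowSupport w c ⊆ N
  have hSD : ∀ c ∈ S, D c := fun c hc => Finset.subset_biUnion_of_mem (rowSupport w) hc
  classical
  have hIF : ∀ x ∈ I, ¬ D x → x ∈ F := by
    intro x hx hxD
    by_cases hxn : (x : ℕ) < n
    · rcases rowSupport_subset_or_prec w (x := x) (s := s) (by omega) with h | h
      · exact absurd (h.trans (hSD s hs)) hxD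
      · exact mem_firstElems_of_prec hx (hS hs) h
    · rcases rowSupport_subset_or_prec w (x := x) (s := t) (by omega) with h | h
      · exact absurd (h.trans (hSD t ht)) hxD
      · exact mem_firstElems_of_prec hx (hS ht) h
  obtain ⟨φ, hφ, him, hw⟩ := (mem_bases_iff w K).1 hK
  -- Columns of `K` supported in `N` are matched into `N`, fewer than `S.card` rows; the other
  -- columns of `I` already lie in `F`. Together `I ∩ K` is smaller than `F`, which has `r`
  -- elements.
  have h1 : ((I ∩ K).filter D).card ≤ N.card := by
    have : (I ∩ K).filter D ⊆ N.image φ := by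
      intro c hc
      rw [Finset.mem_filter, Finset.mem_inter, ← him, Finset.mem_image] at hc
      obtain ⟨⟨-, i, -, rfl⟩, hD⟩ := hc
      exact Finset.mem_image_of_mem φ (hD (mem_rowSupport.2 (hw i)))
    exact (Finset.card_le_card this).trans Finset.card_image_le
  have h2 : ((I ∩ K).filter fun c => ¬ D c).card ≤ (F.filter fun c => ¬ D c).card := by
    refine Finset.card_le_card fun c hc => ?_
    rw [Finset.mem_filter, Finset.mem_inter] at hc
    exact Finset.mem_filter.2 ⟨hIF c hc.1.1 hc.2, hc.2⟩
  have h3 : S.card ≤ (F.filter D).card :=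
    Finset.card_le_card fun c hc => Finset.mem_filter.2 ⟨hS hc, hSD c hc⟩
  have h4 := Finset.card_filter_add_card_filter_not (s := I ∩ K) D
  have h5 := Finset.card_filter_add_card_filter_not (s := F) D
  have h6 : F.card = r := card_firstElems hrI
  omega

theorem lexSet_mem_bases {n r : ℕ} {w : Equiv.Perm (Fin n)} {I K : Finset (Fin (2 * n))}
    (hrn : r ≤ n) (hrI : r ≤ I.card) (hK : K ∈ bases w) (hKI : r ≤ (I ∩ K).card) :
    lexSet r I ∈ bases w := by
  have hJ := card_lexSet hrn hrI
  refine mem_bases_of_hall hJ fun S hS => ?_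
  by_cases hSF : S ⊆ firstElems r I
  · exact card_le_card_biUnion_of_subset_firstElems hrI hK hKI hSF
  obtain ⟨g, hgS, hgF⟩ := Finset.not_subset.1 hSF
  have hg : g ∈ firstElems (n - r) (univ \ firstElems r I) :=
    (Finset.mem_union.1 (hS hgS)).resolve_left hgF
  obtain ⟨z, hz, hmin⟩ := Finset.exists_min_image S position ⟨g, hgS⟩
  have h1 : (rowSupport w z).card ≤ (S.biUnion (rowSupport w)).card :=
    Finset.card_le_card (Finset.subset_biUnion_of_mem (rowSupport w) hz)
  have h2 := card_rowSupport_ge w z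
  -- All columns before `z` lie in `J_r(I)` but not in `S`, so `S` has at most `n - position z`
  -- elements, no more than the support of `z`.
  have hsub : (univ.filter fun c : Fin (2 * n) => position c < position z) ⊆ lexSet r I \ S := by
    intro c hc
    have hcz := (Finset.mem_filter.1 hc).2
    rw [Finset.mem_sdiff]
    exact ⟨mem_lexSet_of_prec hg (lt_of_lt_of_le hcz (hmin g hgS)),
      fun hcS => absurd (hmin c hcS) (not_le.2 hcz)⟩
  have h3 := Finset.card_le_card hsub
  rw [card_filter_position_lt (position_lt z).le, Finset.card_sdiff_of_subset hS, hJ] at h3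
  have h4 := Finset.card_le_card hS
  omega

theorem bases_nonempty {n : ℕ} (w : Equiv.Perm (Fin n)) : (bases w).Nonempty := by
  let φ : Fin n → Fin (2 * n) := fun i => ⟨i + n, by omega⟩
  refine ⟨univ.image φ, (mem_bases_iff w _).2 ⟨φ, fun i j h => ?_, rfl, fun i => ?_⟩⟩
  · have := congrArg Fin.val h
    simp only [φ] at this
    exact Fin.ext (by omega)
  · simp only [φ]; omega

theorem le_rankIn_iff {n r : ℕ} (w : Equiv.Perm (Fin n)) (I : Finset (Fin (2 * n))) :
    r ≤ rankIn (bases w) I ↔ ∃ K ∈ bases w, r ≤ (I ∩ K).card := by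
  have hbdd : BddAbove ((fun K => (I ∩ K).card) '' bases w) := by
    refine ⟨I.card, ?_⟩
    rintro _ ⟨K, -, rfl⟩
    exact Finset.card_le_card Finset.inter_subset_left
  constructor
  · intro h
    obtain ⟨K, hK, hKr⟩ := Nat.sSup_mem ((bases_nonempty w).image _) hbdd
    exact ⟨K, hK, h.trans hKr.ge⟩
  · rintro ⟨K, hK, h⟩
    exact h.trans (le_csSup hbdd ⟨K, hK, rfl⟩)

end CatalanPositroid

theorem mainTheorem4 (n r : ℕ) (w : Equiv.Perm (Fin n)) (I : Finset (Fin (2 * n)))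
    (hrn : r ≤ n) (hrI : r ≤ I.card) :
    CatalanPositroid.IsLexSmallest r I (CatalanPositroid.lexSet r I) ∧
    CatalanPositroid.IsUniqueMaximal
      (CatalanPositroid.permsOf (CatalanPositroid.lexSet r I))
      (CatalanPositroid.uPerm (CatalanPositroid.lexSet r I)) ∧
    (r ≤ CatalanPositroid.rankIn (CatalanPositroid.bases w) I ↔
      CatalanPositroid.lexSet r I ∈ CatalanPositroid.bases w) ∧
    (CatalanPositroid.lexSet r I ∈ CatalanPositroid.bases w ↔
      CatalanPositroid.BruhatLE w (CatalanPositroid.uPerm (CatalanPositroid.lexSet r I))) := by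
  have hcard := CatalanPositroid.card_lexSet hrn hrI
  obtain ⟨u, hu, hle⟩ :=
    (CatalanPositroid.isPrincipal_permsOf _ hcard).exists_isUniqueMaximal
  have hmax : CatalanPositroid.IsUniqueMaximal
      (CatalanPositroid.permsOf (CatalanPositroid.lexSet r I))
      (CatalanPositroid.uPerm (CatalanPositroid.lexSet r I)) := Classical.epsilon_spec ⟨u, hu⟩
  refine ⟨CatalanPositroid.isLexSmallest_lexSet hrn hrI, hmax, ?_, ?_⟩
  · rw [CatalanPositroid.le_rankIn_iff]
    constructor
    · rintro ⟨K, hK, hKr⟩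
      exact CatalanPositroid.lexSet_mem_bases hrn hrI hK hKr
    · intro h
      exact ⟨_, h, by rw [Finset.inter_comm]; exact CatalanPositroid.le_card_lexSet_inter hrI⟩
  · rw [hmax.unique hu]
    exact hle w
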